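/- Let $G$ be a finite simple graph with vertex set $V$ and let $\bar G$ be its complement. For a graph $H$ on $V$ define the following subsets of $\mathbb R^V$. * $\mathrm{NC}(H)$ is the convex hull of the vectors $p\in\{0,1\}^V$ with $p_i+p_j\le 1$ whenever $i\sim j$ in $H$ (classical behaviours). * $\mathrm{Q}(H)$ is the set of vectors $p$ with $p_i=\operatorname{tr}(\rho\,\Pi_i)$ for all $i$, where $\rho$ is a density operator and the $\Pi_i$ are orthogonal projections on some complex Hilbert space, with $\Pi_i\Pi_j=0$ whenever $i\sim j$ in $H$ (quantum behaviours). * $\mathrm{E}_1(H)$ is the set of $p\ge 0$ with $\sum_{i\in C}p_i\le 1$ for every clique $C$ of $H$. For $A\subseteq\mathbb R^V_{\ge 0}$ let $\operatorname{abl}A=\{b\ge 0:\ \sum_i a_ib_i\le 1\ \ \forall a\in A\}$. Given a set $U\subseteq \mathrm{E}_1(\bar G)$ of behaviours of the complementary experiment $\bar G$, let $Y(G)$ denote the set of behaviours allowed by the Exclusivity Principle (EP) for the independent experiment $G$. It consists of all $p\ge 0$ such that, for every $p'\in U$ and every set of pairwise exclusive composite events among $f_{ii}=e_i\wedge e_i'$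 ($i\in V$), with joint probabilities $p_ip'_i$, the sum of the probabilities is at most $1$. Here exclusivity of composite events is adjacency in the disjunctive product of $G$ and $\bar G$, in which $(i,j)$ and $(k,l)$ are adjacent iff $i\sim k$ in $G$ or $j\sim l$ in $\bar G$. 1. Let $U$ be a post-quantum theory for $\bar G$, that is, $\mathrm{Q}(\bar G)\subsetneq U\subseteq \mathrm{E}_1(\bar G)$. Then $Y(G)=\operatorname{abl}U$, this set is strictly contained in $\mathrm{Q}(G)$, and every quantum behaviour $p\in \mathrm{Q}(G)\setminus\operatorname{abl}U$ that it excludes lies outside $\mathrm{NC}(G)$. 2. Consequently, if every quantum behaviour is accessible, EP excludes post-quantum behaviours: if $X$ is the set of behaviours accessible in the experiment $G$, $U\subseteq \mathrm{E}_1(\bar G)$ is the set of behaviours accessible in the experiment $\bar G$, $\mathrm{Q}(G)\subseteq X$, and EP allows all of $X$ (that is, $X\subseteq Y(G)$, with $Y(G)$ formed from $U$), then $U\subseteq \mathrm{Q}(\bar G)$. -/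

import Mathlib

namespace Exclusivity

section Trace

variable {H : Type} [NormedAddCommGroup H] [InnerProductSpace ℂ H]

/-- `T` has trace `t`: in every Hilbert basis `b` of `H`, the diagonal matrix elements
`⟪b k, T (b k)⟫` of `T` are summable with sum `t`. -/
def HasTrace (T : H →L[ℂ] H) (t : ℂ) : Prop :=
  ∀ (ι : Type) (b : HilbertBasis ι ℂ H), HasSum (fun k => inner ℂ (b k) (T (b k))) t

/-- A quantum state (density operator): a positive operator of trace one. -/
def IsState (ρ : H →L[ℂ] H) : Prop :=
  ρ.IsPositive ∧ HasTrace ρ 1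

end Trace

section Behaviours

variable {V : Type*}

/-- Deterministic noncontextual behaviours of the exclusivity graph `G`. -/
def deterministicSet (G : SimpleGraph V) : Set (V → ℝ) :=
  {p | (∀ i, p i = 0 ∨ p i = 1) ∧ ∀ i j, G.Adj i j → p i + p j ≤ 1}

/-- `NC(G)`: the noncontextual (classical) behaviours. -/
def noncontextualSet (G : SimpleGraph V) : Set (V → ℝ) :=
  convexHull ℝ (deterministicSet G)

/-- `Q(G)`: the quantum behaviours, `p i = tr (ρ Π_i)` for a state `ρ` and orthogonal projections
`Π_i` on a complex Hilbert space, with `Π_i Π_j = 0` for exclusive events `i ∼ j`. -/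
def quantumSet (G : SimpleGraph V) : Set (V → ℝ) :=
  {p | ∃ (H : Type) (_ : NormedAddCommGroup H) (_ : InnerProductSpace ℂ H) (_ : CompleteSpace H)
      (ρ : H →L[ℂ] H) (P : V → H →L[ℂ] H),
      IsState ρ ∧ (∀ i, IsStarProjection (P i)) ∧ (∀ i j, G.Adj i j → P i * P j = 0) ∧
        ∀ i, HasTrace (ρ * P i) (p i : ℂ)}

/-- `E₁(G)`: the nonnegative vectors satisfying the Exclusivity Principle, i.e. the probabilities of
any set of pairwise exclusive events sum to at most one (singletons give `p i ≤ 1`). -/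
def exclusivitySet (G : SimpleGraph V) : Set (V → ℝ) :=
  {p | (∀ i, 0 ≤ p i) ∧ ∀ C : Finset V, G.IsClique (C : Set V) → ∑ i ∈ C, p i ≤ 1}

/-- The anti-blocking set of a set of nonnegative vectors. -/
def abl [Fintype V] (A : Set (V → ℝ)) : Set (V → ℝ) :=
  {b | (∀ i, 0 ≤ b i) ∧ ∀ a ∈ A, ∑ i, a i * b i ≤ 1}

/-- The disjunctive product `G * G'`: the exclusivity graph of the composite events
`f_ij = e_i ∧ e'_j`. -/
def disjunctiveProduct {V' : Type*} (G : SimpleGraph V) (G' : SimpleGraph V') :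
    SimpleGraph (V × V') where
  Adj e f := G.Adj e.1 f.1 ∨ G'.Adj e.2 f.2
  symm := ⟨fun _ _ h => h.imp (fun h => h.symm) (fun h => h.symm)⟩
  loopless := ⟨fun _ h => h.elim (fun h => h.ne rfl) (fun h => h.ne rfl)⟩

/-- The set `Y(G)` of behaviours of the experiment `G` allowed by the Exclusivity Principle when the
behaviours of the independent complementary experiment are those in `U`: for each `p' ∈ U`, the
principle holds for all sets of pairwise exclusive events among the composite events `f_ii`, whose
joint probabilities are `p i * p' i` by independence. -/
def epSet (G : SimpleGraph V) (U : Set (V → ℝ)) : Set (V → ℝ) :=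
  {p | (∀ i, 0 ≤ p i) ∧ ∀ p' ∈ U, ∀ C : Finset (V × V), (C : Set (V × V)) ⊆ Set.diagonal V →
      (disjunctiveProduct G Gᶜ).IsClique (C : Set (V × V)) → ∑ e ∈ C, p e.1 * p' e.2 ≤ 1}

end Behaviours

end Exclusivity

namespace Exclusivity

open Matrix

/-! ### Positive semidefinite completion and its dual -/

section Gram

variable {n : Type*} [Fintype n] [DecidableEq n]

/-! Distinct vertices are adjacent in `G` or in `Gᶜ`, so all the events `f_ii` form one clique and
EP reduces to anti-blocking (`epSet_eq_abl`). The core is `abl (quantumSet Gᶜ) ⊆ quantumSet G`, a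
semidefinite duality: either a partial Gram matrix built from `b` completes, which realises `b` on
`G`, or a dual Gram matrix gives a quantum behaviour of `Gᶜ` that `b` violates. Since anti-blocking
reverses inclusions and is a symmetric relation, strictness and part 2 follow. Classical behaviours
survive because they are already in `abl (exclusivitySet Gᶜ)`. -/

/-- A real positive semidefinite matrix is a Gram matrix. -/
theorem exists_gram_of_posSemidef {M : Matrix n n ℝ} (hM : M.PosSemidef) :
    ∃ v : n → n → ℝ, ∀ i j, M i j = v i ⬝ᵥ v j := by
  open scoped MatrixOrder in
  obtain ⟨B, rfl⟩ := CStarAlgebra.nonneg_iff_eq_star_mul_self.mp hM.nonneg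
  exact ⟨fun i k => B k i, fun i j => by
    simp [star_eq_conjTranspose, Matrix.mul_apply, dotProduct]⟩

omit [DecidableEq n] in
theorem posSemidef_of_dotProduct (v : n → n → ℝ) :
    (Matrix.of fun i j => v i ⬝ᵥ v j).PosSemidef := by
  convert posSemidef_conjTranspose_mul_self (Matrix.of fun k i => v i k) using 1
  ext i j
  simp [Matrix.mul_apply, dotProduct]

/-- The positive semidefinite matrices, with only the entries in `s` retained. -/
def maskedPSD (s : Set (n × n)) : PointedCone ℝ (n × n → ℝ) where
  carrier := {T | ∃ M : Matrix n n ℝ, M.PosSemidef ∧ s.indicator (fun e => M e.1 e.2) = T}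
  zero_mem' := ⟨0, PosSemidef.zero, by ext; simp [Set.indicator]⟩
  add_mem' := by
    rintro _ _ ⟨M, hM, rfl⟩ ⟨N, hN, rfl⟩
    refine ⟨M + N, hM.add hN, ?_⟩
    ext e
    by_cases he : e ∈ s <;> simp [he]
  smul_mem' := by
    rintro c _ ⟨M, hM, rfl⟩
    refine ⟨(c : ℝ) • M, hM.smul c.2, ?_⟩
    ext e
    by_cases he : e ∈ s
    · simp only [Set.indicator_of_mem he, Pi.smul_apply]
      rfl
    · simp only [Set.indicator_of_notMem he, Pi.smul_apply, smul_zero]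

/-- The retained diagonal entries are the squared lengths of the Gram vectors. Near a limit point
they are bounded, so the cone is locally contained in a continuous image of a compact box. -/
theorem isClosed_maskedPSD {s : Set (n × n)} (hs : ∀ i, (i, i) ∈ s) :
    IsClosed (maskedPSD s : Set (n × n → ℝ)) := by
  refine isClosed_of_closure_subset fun Y hY => ?_
  -- `1 ≤ R` turns the bound `R` on squared coordinates into the bound `R` on coordinates.
  obtain ⟨R, hR1, hR⟩ : ∃ R : ℝ, 1 ≤ R ∧ ∀ i, Y (i, i) < R := by
    refine ⟨1 + ∑ i, |Y (i, i)|, by simpa using Finset.sum_nonneg fun i _ => abs_nonneg _,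
      fun i => ?_⟩
    have h := Finset.single_le_sum (f := fun i => |Y (i, i)|) (fun i _ => abs_nonneg _)
      (Finset.mem_univ i)
    linarith [le_abs_self (Y (i, i))]
  let U : Set (n × n → ℝ) := {X | ∀ i, X (i, i) < R}
  have hU : IsOpen U := by
    simp only [U, Set.ofPred_forall]
    exact isOpen_iInter_of_finite fun i => isOpen_lt (continuous_apply _) continuous_const
  let box : Set (n → n → ℝ) := Set.univ.pi fun _ => Set.univ.pi fun _ => Set.Icc (-R) R
  have hbox : IsCompact box := isCompact_univ_pi fun _ => isCompact_univ_pi fun _ => isCompact_Icc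
  let F : (n → n → ℝ) → (n × n → ℝ) := fun v => s.indicator fun e => v e.1 ⬝ᵥ v e.2
  have hF : Continuous F := by
    refine continuous_pi fun e => ?_
    by_cases he : e ∈ s
    · simp only [F, Set.indicator_of_mem he, dotProduct]
      fun_prop
    · simp only [F, Set.indicator_of_notMem he]
      fun_prop
  have hsub : U ∩ (maskedPSD s : Set (n × n → ℝ)) ⊆ F '' box := by
    rintro _ ⟨hX, M, hM, rfl⟩
    obtain ⟨v, hv⟩ := exists_gram_of_posSemidef hM
    refine ⟨v, fun i _ k _ => ?_, ?_⟩
    · have h1 : v i ⬝ᵥ v i < R := by simpa [hs, hv] using hX i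
      have h2 : v i k * v i k ≤ v i ⬝ᵥ v i :=
        Finset.single_le_sum (f := fun k => v i k * v i k) (fun k _ => mul_self_nonneg _)
          (Finset.mem_univ k)
      exact abs_le.mp (abs_le_of_sq_le_sq (by nlinarith) (by linarith))
    · simp only [F, ← hv]
  have hmem : Y ∈ F '' box :=
    ((hbox.image hF).isClosed.closure_subset_iff.mpr hsub) (hU.inter_closure ⟨hR, hY⟩)
  obtain ⟨v, -, rfl⟩ := hmem
  exact ⟨_, posSemidef_of_dotProduct v, rfl⟩

/-- Theorem of the alternative for completing a partial symmetric matrix `T`, specified on a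
symmetric pattern `s` containing the diagonal, to a Gram matrix. -/
theorem exists_gram_completion_or_dual {s : Set (n × n)} (hs : ∀ i, (i, i) ∈ s)
    (hsymm : ∀ e ∈ s, e.swap ∈ s) {T : n × n → ℝ} (hT : ∀ e, T e.swap = T e) :
    (∃ v : n → n → ℝ, ∀ e ∈ s, v e.1 ⬝ᵥ v e.2 = T e) ∨
      ∃ w : n → n → ℝ, (∀ e ∉ s, w e.1 ⬝ᵥ w e.2 = 0) ∧
        ∑ e, T e * (w e.1 ⬝ᵥ w e.2) < 0 := by
  classical
  by_cases hmem : s.indicator T ∈ maskedPSD s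
  · left
    obtain ⟨M, hM, hMT⟩ := hmem
    obtain ⟨v, hv⟩ := exists_gram_of_posSemidef hM
    refine ⟨v, fun e he => ?_⟩
    simpa [he, hv] using congrFun hMT e
  · right
    let C : ProperCone ℝ (n × n → ℝ) := ⟨maskedPSD s, isClosed_maskedPSD hs⟩
    obtain ⟨f, hf, hfT⟩ := C.hyperplane_separation_point hmem
    let c : n × n → ℝ := s.indicator fun e => f (Pi.single e 1)
    have hfc : ∀ X : n × n → ℝ, f (s.indicator X) = ∑ e, X e * c e := by
      intro X
      have h := f.toLinearMap.pi_apply_eq_sum_univ (s.indicator X)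
      refine h.trans (Finset.sum_congr rfl fun e _ => ?_)
      have h1 : (fun j => if e = j then (1 : ℝ) else 0) = Pi.single e 1 := by
        ext j; simp [Pi.single_apply, eq_comm]
      rw [h1]
      by_cases he : e ∈ s <;> simp [c, he]
    have hswap : ∀ X : n × n → ℝ, ∑ e, X e * c e.swap = ∑ e, X e.swap * c e := fun X =>
      Fintype.sum_equiv (Equiv.prodComm n n) _ _ fun e => by simp
    -- The separating functional need not be symmetric. Symmetrising its coefficients keeps the
    -- support in `s` and doubles its value at the symmetric `T`; nonnegativity on rank-one matrices
    -- makes `Z` positive semidefinite.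
    let Z : Matrix n n ℝ := Matrix.of fun i j => c (i, j) + c (j, i)
    have hZ : Z.PosSemidef := by
      refine .of_dotProduct_mulVec_nonneg (by ext i j; simp [Z, add_comm]) fun x => ?_
      have h := hf (s.indicator fun e => x e.1 * x e.2)
        ⟨vecMulVec x (star x), posSemidef_vecMulVec_self_star x, rfl⟩
      rw [hfc] at h
      have h2 := hswap fun e => x e.1 * x e.2
      have : star x ⬝ᵥ Z *ᵥ x =
          ∑ e : n × n, x e.1 * x e.2 * c e + ∑ e : n × n, x e.1 * x e.2 * c e.swap := by
        rw [← Finset.sum_add_distrib, Fintype.sum_prod_type]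
        simp only [dotProduct, mulVec, Finset.mul_sum, Z, of_apply, Pi.star_apply, star_trivial,
          Prod.swap_prod_mk]
        exact Finset.sum_congr rfl fun i _ => Finset.sum_congr rfl fun j _ => by ring
      rw [this, h2]
      simp only [Prod.fst_swap, Prod.snd_swap]
      have h3 : ∑ e : n × n, x e.2 * x e.1 * c e = ∑ e : n × n, x e.1 * x e.2 * c e :=
        Finset.sum_congr rfl fun e _ => by ring
      rw [h3]
      linarith
    obtain ⟨w, hw⟩ := exists_gram_of_posSemidef hZ
    have hw' : ∀ e : n × n, w e.1 ⬝ᵥ w e.2 = c e + c e.swap := fun e => (hw e.1 e.2).symm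
    refine ⟨w, fun e he => ?_, ?_⟩
    · have he' : e.swap ∉ s := fun h => he (by simpa using hsymm _ h)
      simp [hw', c, he, he']
    · simp only [hw', mul_add, Finset.sum_add_distrib, hswap, hT]
      rw [hfc] at hfT
      linarith

end Gram

/-! ### Quantum behaviours and anti-blocking duality -/

section Quantum

variable {V : Type*}

/-- An orthogonal representation `v` of `G` and a unit vector `d` define a quantum behaviour. -/
theorem mem_quantumSet_of_orthogonal {ι : Type*} [Fintype ι] (G : SimpleGraph V) (d : ι → ℝ)
    (v : V → ι → ℝ) (hd : d ⬝ᵥ d = 1) (hv : ∀ i j, G.Adj i j → v i ⬝ᵥ v j = 0) :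
    (fun i => (d ⬝ᵥ v i) ^ 2 / (v i ⬝ᵥ v i)) ∈ quantumSet G := by
  let e := Fintype.equivFin ι
  let φ : (ι → ℝ) → EuclideanSpace ℂ (Fin (Fintype.card ι)) := fun x =>
    WithLp.toLp 2 fun k => (x (e.symm k) : ℂ)
  have hφ : ∀ x y, inner ℂ (φ x) (φ y) = ((x ⬝ᵥ y : ℝ) : ℂ) := by
    intro x y
    simp only [φ, PiLp.inner_apply, RCLike.inner_apply, Complex.conj_ofReal, dotProduct,
      Complex.ofReal_sum, Complex.ofReal_mul]
    rw [e.symm.sum_comp fun k => (y k : ℂ) * (x k : ℂ)]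
    exact Finset.sum_congr rfl fun _ _ => mul_comm _ _
  have hnorm : ∀ x, ‖φ x‖ ^ 2 = x ⬝ᵥ x := fun x => by
    rw [← inner_self_eq_norm_sq (𝕜 := ℂ), hφ]; rfl
  have htr : ∀ T : EuclideanSpace ℂ (Fin (Fintype.card ι)) →L[ℂ] _, IsSelfAdjoint T →
      HasTrace (InnerProductSpace.rankOne ℂ (φ d) (φ d) * T) (inner ℂ (T (φ d)) (φ d)) := by
    intro T hT κ b
    -- Parseval's identity, once `T` is moved across the inner product.
    refine (b.hasSum_inner_mul_inner (T (φ d)) (φ d)).congr_fun fun k => ?_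
    rw [mul_apply_eq_comp, InnerProductSpace.rankOne_apply, inner_smul_right,
      ← ContinuousLinearMap.adjoint_inner_left, hT.adjoint_eq]
  refine ⟨_, _, _, inferInstance, InnerProductSpace.rankOne ℂ (φ d) (φ d),
    fun i => (ℂ ∙ φ (v i)).starProjection,
    ⟨InnerProductSpace.isPositive_rankOne_self _, ?_⟩,
    fun i => isStarProjection_starProjection, fun i j hij => ?_, fun i => ?_⟩
  · have h := htr 1 (.one _)
    rwa [mul_one, one_apply_eq_self, hφ, hd, Complex.ofReal_one] at h
  · refine Submodule.IsOrtho.starProjection_comp_starProjection ?_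
    rw [Submodule.isOrtho_span]
    simp [hφ, hv i j hij]
  · have h := htr _ (isStarProjection_starProjection (U := ℂ ∙ φ (v i))).isSelfAdjoint
    rw [Submodule.starProjection_singleton, inner_smul_left, hφ, hnorm, RCLike.ofReal_eq_complex_ofReal,
      ← Complex.ofReal_div, Complex.conj_ofReal, ← Complex.ofReal_mul, dotProduct_comm (v i) d] at h
    convert h using 2
    ring

variable [Fintype V]

/-- The anti-blocking set of the quantum behaviours of the complementary graph consists of quantum
behaviours. -/
theorem abl_quantumSet_compl_subset (G : SimpleGraph V) : abl (quantumSet Gᶜ) ⊆ quantumSet G := by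
  classical
  rintro b ⟨hb0, hb⟩
  -- `none` indexes the state vector. Only the pairs of vertices adjacent in `Gᶜ` are left free.
  let s : Set (Option V × Option V) :=
    {e | ∀ i ∈ e.1, ∀ j ∈ e.2, i = j ∨ G.Adj i j}
  let T : Option V × Option V → ℝ
    | (none, none) => 1
    | (none, some i) => b i
    | (some i, none) => b i
    | (some i, some j) => if i = j then b i else 0
  rcases exists_gram_completion_or_dual (s := s) (T := T) (fun i j hj k hk => by
      left; exact Option.mem_unique hj hk) (fun e he i hi j hj =>
        (he j hj i hi).imp Eq.symm SimpleGraph.Adj.symm) (by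
      rintro ⟨_ | i, _ | j⟩ <;> simp [T, eq_comm]
      grind) with ⟨v, hv⟩ | ⟨w, hw, hneg⟩
  · have h00 : v none ⬝ᵥ v none = 1 := hv (none, none) (by simp [s])
    have h0 : ∀ i, v none ⬝ᵥ v (some i) = b i := fun i => hv (none, some i) (by simp [s])
    have hii : ∀ i, v (some i) ⬝ᵥ v (some i) = b i := fun i => by
      simpa [T] using hv (some i, some i) (by simp [s])
    have hij : ∀ i j, G.Adj i j → v (some i) ⬝ᵥ v (some j) = 0 := fun i j h => by
      simpa [T, h.ne] using hv (some i, some j) (by simp [s, h])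
    convert mem_quantumSet_of_orthogonal G (v none) (fun i => v (some i)) h00 hij with i
    -- This covers `b i = 0` too, as `0 / 0 = 0`.
    rw [h0, hii, sq, mul_self_div_self]
  · exfalso
    set r := w none ⬝ᵥ w none with hr
    let q : V → ℝ := fun i => (w none ⬝ᵥ w (some i)) ^ 2 / (w (some i) ⬝ᵥ w (some i))
    have hsum : r + ∑ i, b i * (2 * (w none ⬝ᵥ w (some i)) + w (some i) ⬝ᵥ w (some i)) < 0 := by
      refine lt_of_eq_of_lt ?_ hneg
      simp only [Fintype.sum_prod_type, Fintype.sum_option, T, ite_mul, zero_mul,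
        Finset.sum_ite_eq, Finset.mem_univ, if_true, one_mul, ← hr]
      rw [add_assoc, ← Finset.sum_add_distrib]
      congr 1
      refine Finset.sum_congr rfl fun i _ => ?_
      rw [dotProduct_comm (w (some i)) (w none)]
      ring
    -- Complete the square; `q i` is `r` times the probability given by the normalised state `w
    -- none`.
    have hq : ∀ i, -q i ≤ 2 * (w none ⬝ᵥ w (some i)) + w (some i) ⬝ᵥ w (some i) := by
      intro i
      rcases eq_or_ne (w (some i)) 0 with h | h
      · simp [q, h]
      · have hpos : 0 < w (some i) ⬝ᵥ w (some i) := by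
          simpa using dotProduct_star_self_pos_iff.mpr h
        have : 0 ≤ (w none ⬝ᵥ w (some i) + w (some i) ⬝ᵥ w (some i)) ^ 2 /
            (w (some i) ⬝ᵥ w (some i)) := by positivity
        have h2 : (w none ⬝ᵥ w (some i) + w (some i) ⬝ᵥ w (some i)) ^ 2 /
            (w (some i) ⬝ᵥ w (some i)) =
            q i + (2 * (w none ⬝ᵥ w (some i)) + w (some i) ⬝ᵥ w (some i)) := by
          simp only [q]; field_simp; ring
        linarith
    have hlt : r < ∑ i, b i * q i := by
      have : ∑ i, b i * -q i ≤
          ∑ i, b i * (2 * (w none ⬝ᵥ w (some i)) + w (some i) ⬝ᵥ w (some i)) :=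
        Finset.sum_le_sum fun i _ => mul_le_mul_of_nonneg_left (hq i) (hb0 i)
      simp only [mul_neg, Finset.sum_neg_distrib] at this
      linarith
    rcases eq_or_ne (w none) 0 with h | h
    · simp [hr, q, h] at hlt
    · have hpos : 0 < r := by simpa [hr] using dotProduct_star_self_pos_iff.mpr h
      have hmem := mem_quantumSet_of_orthogonal Gᶜ ((√r)⁻¹ • w none) (fun i => w (some i))
        (by rw [smul_dotProduct, dotProduct_smul, ← hr, smul_eq_mul, smul_eq_mul, ← mul_assoc,
              ← mul_inv, Real.mul_self_sqrt hpos.le, inv_mul_cancel₀ hpos.ne'])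
        (fun i j hij => hw (some i, some j) fun h => by
          rcases h i rfl j rfl with h | h
          · exact hij.ne h
          · exact (SimpleGraph.compl_adj _ _ _ |>.mp hij).2 h)
      have hle := hb _ hmem
      have heq : ∑ i, ((√r)⁻¹ • w none ⬝ᵥ w (some i)) ^ 2 / (w (some i) ⬝ᵥ w (some i)) * b i =
          r⁻¹ * ∑ i, b i * q i := by
        rw [Finset.mul_sum]
        refine Finset.sum_congr rfl fun i _ => ?_
        rw [smul_dotProduct, smul_eq_mul, mul_pow, inv_pow, Real.sq_sqrt hpos.le]
        simp only [q]
        ring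
      rw [heq, inv_mul_le_iff₀ hpos, mul_one] at hle
      linarith

theorem abl_anti {A B : Set (V → ℝ)} (h : A ⊆ B) : abl B ⊆ abl A :=
  fun _ hb => ⟨hb.1, fun a ha => hb.2 a (h ha)⟩

/-- Nonnegative vectors satisfy the symmetric form of the anti-blocking relation. -/
theorem subset_abl_comm {A B : Set (V → ℝ)} (hB : ∀ p ∈ B, ∀ i, 0 ≤ p i) (h : A ⊆ abl B) :
    B ⊆ abl A :=
  fun p hp => ⟨hB p hp, fun a ha => by simpa only [mul_comm] using (h ha).2 p hp⟩

theorem epSet_eq_abl (G : SimpleGraph V) {U : Set (V → ℝ)} (hU : ∀ p ∈ U, ∀ i, 0 ≤ p i) :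
    epSet G U = abl U := by
  classical
  ext p
  refine and_congr_right fun hp => forall₂_congr fun p' hp' => ⟨fun h => ?_, fun h C hC _ => ?_⟩
  · have hdiag : ∀ e ∈ (Finset.univ : Finset V).diag, e.1 = e.2 := fun e he =>
      (Finset.mem_diag.mp he).2
    have := h Finset.univ.diag (fun e he => hdiag e he) (by
      rintro ⟨i, i'⟩ hi ⟨j, j'⟩ hj hne
      obtain rfl : i = i' := hdiag _ hi
      obtain rfl : j = j' := hdiag _ hj
      have hij : i ≠ j := fun h => hne (by rw [h])
      by_cases hadj : G.Adj i j
      · exact Or.inl hadj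
      · exact Or.inr ((SimpleGraph.compl_adj _ _ _).mpr ⟨hij, hadj⟩))
    rw [Finset.sum_diag] at this
    simpa only [mul_comm] using this
  · calc ∑ e ∈ C, p e.1 * p' e.2 ≤ ∑ e ∈ Finset.univ.diag, p e.1 * p' e.2 :=
          Finset.sum_le_sum_of_subset_of_nonneg
            (fun e he => Finset.mem_diag.mpr ⟨Finset.mem_univ _, hC he⟩)
            (fun e _ _ => mul_nonneg (hp _) (hU p' hp' _))
      _ = ∑ i, p' i * p i := by simp only [Finset.sum_diag, mul_comm]
      _ ≤ 1 := h

theorem convex_abl (A : Set (V → ℝ)) : Convex ℝ (abl A) := by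
  rintro p ⟨hp, hp'⟩ q ⟨hq, hq'⟩ s t hs ht hst
  refine ⟨fun i => add_nonneg (mul_nonneg hs (hp i)) (mul_nonneg ht (hq i)), fun a ha => ?_⟩
  calc ∑ i, a i * (s • p + t • q) i = s * ∑ i, a i * p i + t * ∑ i, a i * q i := by
        simp only [Finset.mul_sum, ← Finset.sum_add_distrib, Pi.add_apply, Pi.smul_apply,
          smul_eq_mul]
        exact Finset.sum_congr rfl fun i _ => by ring
    _ ≤ s * 1 + t * 1 := by gcongr <;> [exact hp' a ha; exact hq' a ha]
    _ = 1 := by linarith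

/-- The support of a deterministic behaviour is independent in `G`, hence a clique of `Gᶜ`;
convexity of `abl` does the rest. -/
theorem noncontextualSet_subset_abl (G : SimpleGraph V) :
    noncontextualSet G ⊆ abl (exclusivitySet Gᶜ) := by
  classical
  refine convexHull_min ?_ (convex_abl _)
  rintro p ⟨hp, hadj⟩
  refine ⟨fun i => by rcases hp i with h | h <;> simp [h], fun a ha => ?_⟩
  have hclique := ha.2 {i | p i = 1} (by
    intro i hi j hj hij
    simp only [Finset.coe_filter, Finset.mem_univ, true_and, Set.mem_ofPred_eq] at hi hj
    refine (SimpleGraph.compl_adj _ _ _).mpr ⟨hij, fun h => ?_⟩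
    linarith [hadj i j h])
  rw [Finset.sum_filter] at hclique
  refine le_of_eq_of_le (Finset.sum_congr rfl fun i _ => ?_) hclique
  rcases hp i with h | h <;> simp [h]

/-- Swap the two sides of the anti-blocking relation, then apply the duality to `Gᶜ`. -/
theorem subset_quantumSet_compl (G : SimpleGraph V) {U : Set (V → ℝ)}
    (hU : ∀ p ∈ U, ∀ i, 0 ≤ p i) (h : quantumSet G ⊆ abl U) : U ⊆ quantumSet Gᶜ := by
  have := subset_abl_comm hU h
  rw [← compl_compl G] at this
  exact this.trans (abl_quantumSet_compl_subset Gᶜ)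

end Quantum

end Exclusivity

open Exclusivity in
theorem mainTheorem1 {V : Type*} [Fintype V] (G : SimpleGraph V) :
    (∀ U : Set (V → ℝ),
      Exclusivity.quantumSet Gᶜ ⊂ U → U ⊆ Exclusivity.exclusivitySet Gᶜ →
        Exclusivity.epSet G U = Exclusivity.abl U ∧
        Exclusivity.abl U ⊂ Exclusivity.quantumSet G ∧
        ∀ p ∈ Exclusivity.quantumSet G \ Exclusivity.abl U,
          p ∉ Exclusivity.noncontextualSet G) ∧
    (∀ X U : Set (V → ℝ),
      Exclusivity.quantumSet G ⊆ X → U ⊆ Exclusivity.exclusivitySet Gᶜ →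
        X ⊆ Exclusivity.epSet G U → U ⊆ Exclusivity.quantumSet Gᶜ) := by
  refine ⟨fun U hQU hU => ?_, fun X U hX hU hXU => ?_⟩
  · have hpos : ∀ p ∈ U, ∀ i, 0 ≤ p i := fun p hp => (hU hp).1
    exact ⟨epSet_eq_abl G hpos,
      ⟨(abl_anti hQU.1).trans (abl_quantumSet_compl_subset G),
        fun h => hQU.2 (subset_quantumSet_compl G hpos h)⟩,
      fun p hp hnc => hp.2 (abl_anti hU (noncontextualSet_subset_abl G hnc))⟩
  · have hpos : ∀ p ∈ U, ∀ i, 0 ≤ p i := fun p hp => (hU hp).1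
    exact subset_quantumSet_compl G hpos ((hX.trans hXU).trans (epSet_eq_abl G hpos).subset)
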